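/- Let $(G,w)$ be an edge-weighted graph: $G$ is a finite simple graph and $w:E(G)\to\mathbb R$. A tuple of $|V(G)|$ points of $\mathbb R^2$ is a distance $G$-configuration (respectively, a dot product $G$-configuration) if there is a bijection $\varphi$ from $V(G)$ onto the set of points of the tuple such that for every edge $\{u,v\}\in E(G)$ the distance between $\varphi(u)$ and $\varphi(v)$ (respectively, the dot product $\varphi(u)\cdot\varphi(v)$) equals $w(\{u,v\})$. Let $f(G;n)$ (respectively, $g(G;n)$) be the maximum, over all sets $E\subset\mathbb R^2$ of $n$ points, of the number of distance (respectively, dot product) $G$-configurations formed by points of $E$. A graph $H$ can be $(s,t)$-covered if it contains $s$ paths on two vertices and $t$ paths on three vertices, as (not necessarily induced) subgraphs, that are pairwise vertex-disjoint and together contain every vertex of $H$. Suppose that $G$ has a subgraph $H$ (not necessarily induced) that can be $(s,t)$-covered. Then there are constants $C$ and $N$, depending only on $G$, $H$, $s$ and $t$ (and not on $n$ or on the weights), such that for all $n>N$ and all weight functions $w$ $$f(G;n)\le C\,n^{\frac43 s+2t+|V(G)\setminus V(H)|},$$ and, for all weight functions $w$ all of whose values are nonzero, $$g(G;n)\le C\,n^{\frac43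 s+2t+|V(G)\setminus V(H)|}.$$ -/

import Mathlib

/-- The Euclidean plane. -/
abbrev Plane : Type := EuclideanSpace ℝ (Fin 2)

/-- The edge-weighted graph `(G, w)` is realised by the tuple `x` of `|V(G)|` points of the plane,
with respect to the symmetric quantity `δ` (distance or dot product): there is a bijection `φ` from
`V(G)` onto the set of points of the tuple such that `δ (φ u) (φ v) = w {u, v}` for every edge
`{u, v}`. As the tuple has exactly `|V(G)|` entries, its entries are then pairwise distinct. -/
def IsConfiguration {V : Type*} [Fintype V] (δ : Plane → Plane → ℝ)
    (G : SimpleGraph V) (w : G.edgeSet → ℝ) (x : Fin (Fintype.card V) → Plane) : Prop :=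
  ∃ φ : V → Plane, Set.BijOn φ Set.univ (Set.range x) ∧
    ∀ (u v : V) (h : G.Adj u v), δ (φ u) (φ v) = w ⟨s(u, v), G.mem_edgeSet.mpr h⟩

/-- `x` is a distance `G`-configuration. -/
def IsDistanceConfiguration {V : Type*} [Fintype V]
    (G : SimpleGraph V) (w : G.edgeSet → ℝ) (x : Fin (Fintype.card V) → Plane) : Prop :=
  IsConfiguration (fun p q => dist p q) G w x

/-- `x` is a dot product `G`-configuration. -/
def IsDotProductConfiguration {V : Type*} [Fintype V]
    (G : SimpleGraph V) (w : G.edgeSet → ℝ) (x : Fin (Fintype.card V) → Plane) : Prop :=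
  IsConfiguration (fun p q => inner ℝ p q) G w x

/-- The number of `k`-tuples of points of the finite set `E` that have the property `P`. -/
noncomputable def tupleCount {k : ℕ} (P : (Fin k → Plane) → Prop) (E : Finset Plane) : ℕ :=
  Set.ncard {x : Fin k → Plane | (∀ i, x i ∈ E) ∧ P x}

/-- The maximum, over all sets `E` of `n` points in the plane, of the number of `k`-tuples of points
of `E` that have the property `P`. -/
noncomputable def maxTupleCount {k : ℕ} (P : (Fin k → Plane) → Prop) (n : ℕ) : ℕ :=
  sSup {c : ℕ | ∃ E : Finset Plane, E.card = n ∧ tupleCount P E = c}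

/-- The tuples counted by `tupleCount` form a finite set. -/
theorem tupleCount_finite {k : ℕ} (P : (Fin k → Plane) → Prop) (E : Finset Plane) :
    {x : Fin k → Plane | (∀ i, x i ∈ E) ∧ P x}.Finite :=
  (Finset.finite_toSet (Fintype.piFinset fun _ : Fin k => E)).subset fun x hx => by
    simpa [Fintype.mem_piFinset] using hx.1

theorem tupleCount_le {k : ℕ} (P : (Fin k → Plane) → Prop) (E : Finset Plane) :
    tupleCount P E ≤ E.card ^ k := by
  have h : {x : Fin k → Plane | (∀ i, x i ∈ E) ∧ P x} ⊆
      ((Fintype.piFinset fun _ : Fin k => E : Finset (Fin k → Plane)) : Set (Fin k → Plane)) :=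
    fun x hx => by simpa [Fintype.mem_piFinset] using hx.1
  have h2 := Set.ncard_le_ncard h (Finset.finite_toSet _)
  rw [Set.ncard_coe_finset] at h2
  simpa [tupleCount] using h2

/-- The supremum in `maxTupleCount` is attained: it is a maximum. -/
theorem maxTupleCount_isGreatest {k : ℕ} (P : (Fin k → Plane) → Prop) (n : ℕ) :
    IsGreatest {c : ℕ | ∃ E : Finset Plane, E.card = n ∧ tupleCount P E = c}
      (maxTupleCount P n) := by
  have hb : BddAbove {c : ℕ | ∃ E : Finset Plane, E.card = n ∧ tupleCount P E = c} := by
    refine ⟨n ^ k, ?_⟩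
    rintro c ⟨E, rfl, rfl⟩
    exact tupleCount_le P E
  have hn : {c : ℕ | ∃ E : Finset Plane, E.card = n ∧ tupleCount P E = c}.Nonempty := by
    have : Infinite Plane := Module.Free.infinite ℝ Plane
    obtain ⟨E, hE⟩ := Infinite.exists_subset_card_eq Plane n
    exact ⟨_, E, hE, rfl⟩
  exact ⟨Nat.sSup_mem hn hb, fun c hc => le_csSup hb hc⟩

/-- `f(G; n)`: the maximum number of distance `G`-configurations in a set of `n` points. -/
noncomputable def maxDistanceConfigurations {V : Type*} [Fintype V]
    (G : SimpleGraph V) (w : G.edgeSet → ℝ) (n : ℕ) : ℕ :=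
  maxTupleCount (IsDistanceConfiguration G w) n

/-- `g(G; n)`: the maximum number of dot product `G`-configurations in a set of `n` points. -/
noncomputable def maxDotProductConfigurations {V : Type*} [Fintype V]
    (G : SimpleGraph V) (w : G.edgeSet → ℝ) (n : ℕ) : ℕ :=
  maxTupleCount (IsDotProductConfiguration G w) n

/-- `G` can be `(s, t)`-covered: there are `s` copies of the path on two vertices and `t` copies of
the path on three vertices in `G` (not necessarily induced), pairwise vertex-disjoint, that together
contain every vertex. Bijectivity of the joint vertex map says that the copies are disjoint
(injective) and cover (surjective). -/
def CanBeCovered {V : Type*} (G : SimpleGraph V) (s t : ℕ) : Prop :=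
  ∃ (p : Fin s → SimpleGraph.Copy (SimpleGraph.pathGraph 2) G)
    (q : Fin t → SimpleGraph.Copy (SimpleGraph.pathGraph 3) G),
    Function.Bijective (Sum.elim (fun a : Fin s × Fin 2 => p a.1 a.2)
      (fun b : Fin t × Fin 3 => q b.1 b.2))

/-! A labelled configuration is determined by its restrictions to the pieces of the cover and to the
vertices outside `H`, and forgetting all other edges only enlarges the count. So it suffices to
find, among n points, O(n^(4/3)) pairs with a prescribed distance or nonzero dot product and O(n^2)
three-point paths with prescribed weights, uniformly in the weights; each remaining vertex has at
most n positions.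

The path bounds `card_triples_dist_le` and `card_triples_inner_le` are elementary: two circles with
distinct centres share at most two points, and two independent linear equations have one solution.

The pair bounds come from Szemerédi–Trotter (`incidences_le`) for `x`-monotone curves meeting at
most once: upper half circles of one radius, or lines. This is Székely's argument. Joining
consecutive points on each curve gives a drawing with at least |I| - |C| arcs and at most |C|^2
ordered crossing pairs, to which the sampled crossing inequality `amplify_crossing_bound` applies.
Its planar input, `card_arcs_le_of_noncrossing`, avoids Euler's formula: every arc is topmost at its
left end, topmost at its right end, or directly below some vertex, and each class injects into the
vertices. -/

/-! ### Non-crossing `x`-monotone arcs -/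

/-- A finite family `T` of arcs `e`, each the graph of the continuous function `g e` between its
endpoints `l e` and `r e`, drawn on the vertex set `P` without vertices in the interior of arcs. -/
structure IsArcSystem {ε : Type*} (P : Finset (ℝ × ℝ)) (T : Finset ε) (l r : ε → ℝ × ℝ)
    (g : ε → ℝ → ℝ) : Prop where
  cont : ∀ e ∈ T, Continuous (g e)
  lt : ∀ e ∈ T, (l e).1 < (r e).1
  left_eq : ∀ e ∈ T, g e (l e).1 = (l e).2
  right_eq : ∀ e ∈ T, g e (r e).1 = (r e).2
  left_mem : ∀ e ∈ T, l e ∈ P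
  right_mem : ∀ e ∈ T, r e ∈ P
  clean : ∀ e ∈ T, ∀ p ∈ P, (l e).1 < p.1 → p.1 < (r e).1 → g e p.1 ≠ p.2
  simple : ∀ e ∈ T, ∀ e' ∈ T, l e = l e' → r e = r e' → e = e'

/-- The interiors of two arcs meet. -/
def ArcsCross {ε : Type*} (l r : ε → ℝ × ℝ) (g : ε → ℝ → ℝ) (e e' : ε) : Prop :=
  ∃ x, (l e).1 < x ∧ x < (r e).1 ∧ (l e').1 < x ∧ x < (r e').1 ∧ g e x = g e' x

/-- The arc `e` is directly below the point `w`. -/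
def IsDirectlyBelow {ε : Type*} (T : Finset ε) (l r : ε → ℝ × ℝ) (g : ε → ℝ → ℝ) (e : ε)
    (w : ℝ × ℝ) : Prop :=
  (l e).1 < w.1 ∧ w.1 < (r e).1 ∧ g e w.1 < w.2 ∧
    ∀ e' ∈ T, (l e').1 < w.1 → w.1 < (r e').1 → g e w.1 < g e' w.1 → w.2 ≤ g e' w.1

/-- The arc `e'` is above `e` somewhere over the interiors of both. -/
def IsArcAbove {ε : Type*} (l r : ε → ℝ × ℝ) (g : ε → ℝ → ℝ) (e e' : ε) : Prop :=
  ∃ x, (l e).1 < x ∧ x < (r e).1 ∧ (l e').1 < x ∧ x < (r e').1 ∧ g e x < g e' x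

theorem ArcsCross.symm {ε : Type*} {l r : ε → ℝ × ℝ} {g : ε → ℝ → ℝ} {e e' : ε}
    (h : ArcsCross l r g e e') : ArcsCross l r g e' e := by
  obtain ⟨x, h1, h2, h3, h4, h5⟩ := h
  exact ⟨x, h3, h4, h1, h2, h5.symm⟩

/-- Non-crossing arcs keep their vertical order over the common part of their closed domains. -/
theorem le_of_not_arcsCross {ε : Type*} {l r : ε → ℝ × ℝ} {g : ε → ℝ → ℝ} {e e' : ε}
    (hc : Continuous (g e)) (hc' : Continuous (g e')) (h : ¬ ArcsCross l r g e e') {x y : ℝ}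
    (hx : (l e).1 ≤ x ∧ x ≤ (r e).1 ∧ (l e').1 ≤ x ∧ x ≤ (r e').1)
    (hy : (l e).1 ≤ y ∧ y ≤ (r e).1 ∧ (l e').1 ≤ y ∧ y ≤ (r e').1)
    (hlt : g e x < g e' x) : g e y ≤ g e' y := by
  by_contra hcon
  push Not at hcon
  have hcd : ContinuousOn (fun z => g e' z - g e z) (Set.uIcc y x) := (hc'.sub hc).continuousOn
  have h0 : (0 : ℝ) ∈ Set.uIcc (g e' y - g e y) (g e' x - g e x) := by
    rw [Set.mem_uIcc]
    left
    constructor <;> linarith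
  obtain ⟨z, hz, hz0⟩ := intermediate_value_uIcc hcd h0
  simp only at hz0
  have hzx : z ≠ x := by
    rintro rfl
    linarith
  have hzy : z ≠ y := by
    rintro rfl
    linarith
  apply h
  rcases Set.mem_uIcc.1 hz with ⟨h1, h2⟩ | ⟨h1, h2⟩
  · have h1 := lt_of_le_of_ne h1 hzy.symm
    have h2 := lt_of_le_of_ne h2 hzx
    exact ⟨z, by linarith, by linarith, by linarith, by linarith, by linarith⟩
  · have h1 := lt_of_le_of_ne h1 hzx.symm
    have h2 := lt_of_le_of_ne h2 hzy
    exact ⟨z, by linarith, by linarith, by linarith, by linarith, by linarith⟩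

/-- An arc that is topmost neither at its left nor at its right end is directly below a vertex. -/
theorem exists_isDirectlyBelow {ε : Type*} {P : Finset (ℝ × ℝ)} {T : Finset ε} {l r : ε → ℝ × ℝ}
    {g : ε → ℝ → ℝ} (hA : IsArcSystem P T l r g)
    (hnc : ∀ e ∈ T, ∀ e' ∈ T, e ≠ e' → ¬ ArcsCross l r g e e') {e e' e₂ : ε} (he : e ∈ T)
    (he' : e' ∈ T) (hl' : l e' = l e) (ha' : IsArcAbove l r g e e')
    (he₂ : e₂ ∈ T) (hr₂ : r e₂ = r e) (ha₂ : IsArcAbove l r g e e₂) :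
    ∃ w ∈ P, IsDirectlyBelow T l r g e w := by
  classical
  have key : ∀ a ∈ T, ∀ b ∈ T, ∀ x y : ℝ,
      ((l a).1 ≤ x ∧ x ≤ (r a).1 ∧ (l b).1 ≤ x ∧ x ≤ (r b).1) →
      ((l a).1 ≤ y ∧ y ≤ (r a).1 ∧ (l b).1 ≤ y ∧ y ≤ (r b).1) →
      g a x < g b x → g a y ≤ g b y := by
    intro a ha b hb x y hx hy hlt
    refine le_of_not_arcsCross (hA.cont a ha) (hA.cont b hb) (hnc a ha b hb ?_) hx hy hlt
    rintro rfl
    exact lt_irrefl _ hlt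
  have keylt : ∀ a ∈ T, ∀ b ∈ T, ∀ x y : ℝ,
      ((l a).1 ≤ x ∧ x ≤ (r a).1 ∧ (l b).1 ≤ x ∧ x ≤ (r b).1) →
      ((l a).1 < y ∧ y < (r a).1 ∧ (l b).1 < y ∧ y < (r b).1) →
      g a x < g b x → g a y < g b y := by
    intro a ha b hb x y hx hy hlt
    refine lt_of_le_of_ne (key a ha b hb x y hx
      ⟨hy.1.le, hy.2.1.le, hy.2.2.1.le, hy.2.2.2.le⟩ hlt) fun h => ?_
    refine hnc a ha b hb ?_ ⟨y, hy.1, hy.2.1, hy.2.2.1, hy.2.2.2, h⟩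
    rintro rfl
    exact lt_irrefl _ hlt
  have hlt := hA.lt e he
  -- The shortest arc leaving `l e` supplies an abscissa `x₀` interior to all arcs leaving `l e`,
  -- where they can be compared vertically.
  obtain ⟨i₀, hi₀, hmin₀⟩ := Finset.exists_min_image (T.filter fun i => l i = l e)
    (fun i => (r i).1) ⟨e, by simp [he]⟩
  obtain ⟨x₀, hx₀, hx₀'⟩ : ∃ x₀, (l e).1 < x₀ ∧ x₀ < (r i₀).1 := by
    apply exists_between
    rw [Finset.mem_filter] at hi₀
    rw [← hi₀.2]
    exact hA.lt _ hi₀.1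
  have hx₀r : ∀ i ∈ T, l i = l e → x₀ < (r i).1 := fun i hi h =>
    hx₀'.trans_le (hmin₀ i (by simp [hi, h]))
  have hx₀e := hx₀r e he rfl
  have hx₀e' := hx₀r e' he' hl'
  -- `e₁` is the next arc above `e` in the rotation around `l e`.
  obtain ⟨e₁, he₁F, hmin₁⟩ := Finset.exists_min_image
    (T.filter fun i => l i = l e ∧ g e x₀ < g i x₀) (fun i => g i x₀) ⟨e', by
      simp only [Finset.mem_filter]
      refine ⟨he', hl', ?_⟩
      obtain ⟨x, h1, h2, h3, h4, h5⟩ := ha'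
      exact keylt e he e' he' x x₀ ⟨h1.le, h2.le, h3.le, h4.le⟩
        ⟨hx₀, hx₀e, by rw [hl']; exact hx₀, hx₀e'⟩ h5⟩
  simp only [Finset.mem_filter] at he₁F hmin₁
  obtain ⟨he₁, hl₁, hg₁⟩ := he₁F
  have hx₀₁ := hx₀r e₁ he₁ hl₁
  have hu : l e ∈ P := hA.left_mem e he
  have hue := hA.left_eq e he
  have hve := hA.right_eq e he
  have hue₁ : g e₁ (l e).1 = (l e).2 := by rw [← hl₁]; exact hA.left_eq e₁ he₁
  have hr₁ := hA.right_eq e₁ he₁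
  have hl₁' : (l e₁).1 = (l e).1 := by rw [hl₁]
  have hee₁ : ∀ y, (l e).1 ≤ y → y ≤ (r e).1 → y ≤ (r e₁).1 → g e y ≤ g e₁ y := fun y h1 h2 h3 =>
    key e he e₁ he₁ x₀ y ⟨hx₀.le, hx₀e.le, by linarith, hx₀₁.le⟩ ⟨h1, h2, by linarith, h3⟩ hg₁
  -- Vertices in the region between `e` and `e₁`. If `e₁` ends before `e`, its right end is one.
  -- Otherwise `e₁` passes strictly above `r e`, so `e₂`, which reaches `r e` from above `e`, is
  -- trapped in the region and its left end is one.
  have hS : (P.filter fun w => (l e).1 < w.1 ∧ w.1 < (r e).1 ∧ w.1 ≤ (r e₁).1 ∧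
      g e w.1 < w.2 ∧ w.2 ≤ g e₁ w.1).Nonempty := by
    rcases lt_or_ge (r e₁).1 (r e).1 with h | h
    · refine ⟨r e₁, ?_⟩
      simp only [Finset.mem_filter]
      have h0 : (l e).1 < (r e₁).1 := by linarith
      refine ⟨hA.right_mem e₁ he₁, h0, h, le_rfl, lt_of_le_of_ne ?_ ?_, hr₁.ge⟩
      · rw [← hr₁]; exact hee₁ _ h0.le h.le le_rfl
      · exact hA.clean e he _ (hA.right_mem e₁ he₁) h0 h
    · have hne : g e₁ (r e).1 ≠ (r e).2 := by
        intro hcon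
        rcases h.lt_or_eq with h | h
        · exact hA.clean e₁ he₁ _ (hA.right_mem e he) (by linarith) h hcon
        · have : e₁ = e := hA.simple e₁ he₁ e he hl₁ (Prod.ext h.symm (by
            rw [← hr₁, ← hcon, h]))
          rw [this] at hg₁
          exact lt_irrefl _ hg₁
      have hlt₁ : (r e).2 < g e₁ (r e).1 := lt_of_le_of_ne
        (hve ▸ hee₁ _ hlt.le le_rfl h) hne.symm
      have hr₂' : (r e₂).1 = (r e).1 := by rw [hr₂]
      have hg₂ : g e₂ (r e).1 = (r e).2 := by rw [← hr₂]; exact hA.right_eq e₂ he₂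
      have hlt₂ := hA.lt e₂ he₂
      obtain ⟨x, h1, h2, h3, h4, h5⟩ := ha₂
      have hlow : ∀ y, (l e).1 ≤ y → (l e₂).1 ≤ y → y ≤ (r e).1 → g e y ≤ g e₂ y :=
        fun y hy1 hy2 hy3 => key e he e₂ he₂ x y ⟨h1.le, h2.le, h3.le, h4.le⟩
          ⟨hy1, hy3, hy2, by linarith⟩ h5
      have hhigh : ∀ y, (l e).1 ≤ y → (l e₂).1 ≤ y → y ≤ (r e).1 → g e₂ y ≤ g e₁ y :=
        fun y hy1 hy2 hy3 => key e₂ he₂ e₁ he₁ (r e).1 y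
          ⟨by linarith, by linarith, by linarith, by linarith⟩
          ⟨by linarith, by linarith, by linarith, by linarith⟩ (by linarith)
      have hl₂ := hA.left_eq e₂ he₂
      refine ⟨l e₂, ?_⟩
      simp only [Finset.mem_filter]
      have h0 : (l e).1 < (l e₂).1 := by
        by_contra hcon
        push Not at hcon
        have ha := hlow (l e).1 le_rfl hcon hlt.le
        have hb := hhigh (l e).1 le_rfl hcon hlt.le
        have hc : g e₂ (l e).1 = (l e).2 := by linarith
        rcases hcon.lt_or_eq with hcon | hcon
        · exact hA.clean e₂ he₂ _ hu hcon (by linarith) hc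
        · have : e₂ = e := hA.simple e₂ he₂ e he (Prod.ext hcon (by
            rw [← hl₂, ← hc, hcon])) hr₂
          rw [this] at h5
          exact lt_irrefl _ h5
      refine ⟨hA.left_mem e₂ he₂, h0, by linarith, by linarith, lt_of_le_of_ne ?_ ?_, ?_⟩
      · rw [← hl₂]; exact hlow _ h0.le le_rfl (by linarith)
      · exact hA.clean e he _ (hA.left_mem e₂ he₂) h0 (by linarith)
      · rw [← hl₂]; exact hhigh _ h0.le le_rfl (by linarith)
  -- The leftmost such vertex works. An arc `e₃` strictly between `e` and `w` would be trapped in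
  -- the region to the left of `w`: either its left end is a vertex further left, or it starts at `l
  -- e` strictly between `e` and `e₁`, against the choice of `e₁`.
  obtain ⟨w, hw, hwmin⟩ := Finset.exists_min_image _ (fun w : ℝ × ℝ => w.1) hS
  simp only [Finset.mem_filter] at hw hwmin
  obtain ⟨hwP, hw1, hw2, hw3, hw4, hw5⟩ := hw
  refine ⟨w, hwP, hw1, hw2, hw4, fun e₃ he₃ h1 h2 h3 => ?_⟩
  by_contra hcon
  push Not at hcon
  have hlow : ∀ y, (l e).1 ≤ y → (l e₃).1 ≤ y → y ≤ w.1 → g e y ≤ g e₃ y :=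
    fun y hy1 hy2 hy3 => key e he e₃ he₃ w.1 y ⟨by linarith, by linarith, by linarith, by linarith⟩
      ⟨by linarith, by linarith, by linarith, by linarith⟩ h3
  have hhigh : ∀ y, (l e).1 ≤ y → (l e₃).1 ≤ y → y ≤ w.1 → g e₃ y ≤ g e₁ y :=
    fun y hy1 hy2 hy3 => key e₃ he₃ e₁ he₁ w.1 y
      ⟨by linarith, by linarith, by linarith, by linarith⟩
      ⟨by linarith, by linarith, by linarith, by linarith⟩ (by linarith)
  have hl₃ := hA.left_eq e₃ he₃
  rcases lt_or_ge (l e).1 (l e₃).1 with h0 | h0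
  · refine absurd (hwmin (l e₃) ⟨hA.left_mem e₃ he₃, h0, by linarith, by linarith,
      lt_of_le_of_ne ?_ ?_, ?_⟩) (not_le.2 h1)
    · rw [← hl₃]; exact hlow _ h0.le le_rfl h1.le
    · exact hA.clean e he _ (hA.left_mem e₃ he₃) h0 (by linarith)
    · rw [← hl₃]; exact hhigh _ h0.le le_rfl h1.le
  · have ha := hlow (l e).1 le_rfl h0 hw1.le
    have hb := hhigh (l e).1 le_rfl h0 hw1.le
    have hc : g e₃ (l e).1 = (l e).2 := by linarith
    rcases h0.lt_or_eq with h0 | h0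
    · exact hA.clean e₃ he₃ _ hu h0 (by linarith) hc
    · have h3l : l e₃ = l e := Prod.ext h0 (by rw [← hl₃, ← hc, h0])
      have hx₀₃ := hx₀r e₃ he₃ h3l
      have hlt1 : g e x₀ < g e₃ x₀ := keylt e he e₃ he₃ w.1 x₀
        ⟨by linarith, by linarith, by linarith, by linarith⟩
        ⟨by linarith, by linarith, by linarith, by linarith⟩ h3
      have hlt2 : g e₃ x₀ < g e₁ x₀ := keylt e₃ he₃ e₁ he₁ w.1 x₀
        ⟨by linarith, by linarith, by linarith, by linarith⟩
        ⟨by linarith, by linarith, by linarith, by linarith⟩ (by linarith)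
      exact absurd (hmin₁ e₃ ⟨he₃, h3l, hlt1⟩) (not_le.2 hlt2)

/-- A simple plane graph with `x`-monotone edges has at most three times as many edges as
vertices. -/
theorem card_arcs_le_of_noncrossing {ε : Type*} {P : Finset (ℝ × ℝ)} {T : Finset ε}
    {l r : ε → ℝ × ℝ} {g : ε → ℝ → ℝ} (hA : IsArcSystem P T l r g)
    (hnc : ∀ e ∈ T, ∀ e' ∈ T, e ≠ e' → ¬ ArcsCross l r g e e') :
    T.card ≤ 3 * P.card := by
  classical
  have total : ∀ a ∈ T, ∀ b ∈ T, a ≠ b →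
      (∃ x, (l a).1 < x ∧ x < (r a).1 ∧ (l b).1 < x ∧ x < (r b).1) →
      IsArcAbove l r g a b ∨ IsArcAbove l r g b a := by
    rintro a ha b hb hab ⟨x, h1, h2, h3, h4⟩
    rcases lt_trichotomy (g a x) (g b x) with h | h | h
    · exact Or.inl ⟨x, h1, h2, h3, h4, h⟩
    · exact absurd ⟨x, h1, h2, h3, h4, h⟩ (hnc a ha b hb hab)
    · exact Or.inr ⟨x, h3, h4, h1, h2, h⟩
  let TL := T.filter fun e => ∀ e' ∈ T, l e' = l e → ¬ IsArcAbove l r g e e'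
  let TR := T.filter fun e => ∀ e' ∈ T, r e' = r e → ¬ IsArcAbove l r g e e'
  let TB := T.filter fun e => ∃ w ∈ P, IsDirectlyBelow T l r g e w
  have hcover : T ⊆ TL ∪ TR ∪ TB := by
    intro e he
    simp only [TL, TR, TB, Finset.mem_union, Finset.mem_filter, he, true_and]
    by_contra hcon
    push Not at hcon
    obtain ⟨⟨⟨e', he', h1, h2⟩, ⟨e₂, he₂, h3, h4⟩⟩, h5⟩ := hcon
    obtain ⟨w, hw, h⟩ := exists_isDirectlyBelow hA hnc he he' h1 h2 he₂ h3 h4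
    exact h5 w hw h
  have hTL : TL.card ≤ P.card := by
    refine Finset.card_le_card_of_injOn l (fun e he => ?_) fun a ha b hb hab => ?_
    · exact hA.left_mem e (Finset.mem_filter.1 he).1
    · simp only [TL, Finset.coe_filter, Set.mem_ofPred_eq] at ha hb
      by_contra hne
      have h1 := hA.lt a ha.1
      have h2 := hA.lt b hb.1
      have hab' : (l a).1 = (l b).1 := by rw [hab]
      -- Arcs with a common left end overlap just to its right, so one of them is above the other.
      obtain ⟨x, hx, hx'⟩ := exists_between
        (lt_min h1 (hab' ▸ h2 : (l a).1 < (r b).1))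
      rw [lt_min_iff] at hx'
      rcases total a ha.1 b hb.1 hne ⟨x, hx, hx'.1, by linarith, hx'.2⟩ with h | h
      · exact ha.2 b hb.1 hab.symm h
      · exact hb.2 a ha.1 hab h
  have hTR : TR.card ≤ P.card := by
    refine Finset.card_le_card_of_injOn r (fun e he => ?_) fun a ha b hb hab => ?_
    · exact hA.right_mem e (Finset.mem_filter.1 he).1
    · simp only [TR, Finset.coe_filter, Set.mem_ofPred_eq] at ha hb
      by_contra hne
      have h1 := hA.lt a ha.1
      have h2 := hA.lt b hb.1
      have hab' : (r a).1 = (r b).1 := by rw [hab]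
      obtain ⟨x, hx, hx'⟩ := exists_between
        (max_lt h1 (hab' ▸ h2 : (l b).1 < (r a).1))
      rw [max_lt_iff] at hx
      rcases total a ha.1 b hb.1 hne ⟨x, hx.1, hx', hx.2, by linarith⟩ with h | h
      · exact ha.2 b hb.1 hab.symm h
      · exact hb.2 a ha.1 hab h
  have hTB : TB.card ≤ P.card := by
    have hex : ∀ e, ∃ w, e ∈ TB → w ∈ P ∧ IsDirectlyBelow T l r g e w := by
      intro e
      by_cases he : e ∈ TB
      · obtain ⟨w, hw⟩ := (Finset.mem_filter.1 he).2
        exact ⟨w, fun _ => hw⟩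
      · exact ⟨0, fun h => absurd h he⟩
    choose v hv using hex
    refine Finset.card_le_card_of_injOn v (fun e he => (hv e he).1) fun a ha b hb hab => ?_
    obtain ⟨-, a1, a2, a3, a4⟩ := hv a ha
    obtain ⟨-, b1, b2, b3, b4⟩ := hv b hb
    rw [← hab] at b1 b2 b3 b4
    have haT := (Finset.mem_filter.1 ha).1
    have hbT := (Finset.mem_filter.1 hb).1
    by_contra hne
    rcases lt_trichotomy (g a (v a).1) (g b (v a).1) with h | h | h
    · exact absurd (a4 b hbT b1 b2 h) (not_le.2 b3)
    · exact hnc a haT b hbT hne ⟨_, a1, a2, b1, b2, h⟩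
    · exact absurd (b4 a haT a1 a2 h) (not_le.2 a3)
  have := Finset.card_le_card hcover
  have h1 := Finset.card_union_le (TL ∪ TR) TB
  have h2 := Finset.card_union_le TL TR
  omega

/-! ### The crossing inequality -/

theorem IsArcSystem.mono {ε : Type*} {P : Finset (ℝ × ℝ)} {T T' : Finset ε}
    {l r : ε → ℝ × ℝ} {g : ε → ℝ → ℝ} (hA : IsArcSystem P T l r g) (h : T' ⊆ T) :
    IsArcSystem P T' l r g where
  cont e he := hA.cont e (h he)
  lt e he := hA.lt e (h he)
  left_eq e he := hA.left_eq e (h he)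
  right_eq e he := hA.right_eq e (h he)
  left_mem e he := hA.left_mem e (h he)
  right_mem e he := hA.right_mem e (h he)
  clean e he := hA.clean e (h he)
  simple e he e' he' := hA.simple e (h he) e' (h he')

open Classical in
/-- The linear lower bound for the number of crossings. -/
theorem card_arcs_le {ε : Type*} {P : Finset (ℝ × ℝ)} {T : Finset ε}
    {l r : ε → ℝ × ℝ} {g : ε → ℝ → ℝ} (hA : IsArcSystem P T l r g) :
    T.card ≤ 3 * P.card +
      ((T ×ˢ T).filter fun z => z.1 ≠ z.2 ∧ ArcsCross l r g z.1 z.2).card := by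
  set X := (T ×ˢ T).filter fun z => z.1 ≠ z.2 ∧ ArcsCross l r g z.1 z.2 with hX
  -- `X` contains both orders of each crossing pair, so deleting all first components removes every
  -- arc involved in a crossing.
  have h1 : (T \ X.image Prod.fst).card ≤ 3 * P.card := by
    refine card_arcs_le_of_noncrossing (hA.mono Finset.sdiff_subset) fun e he e' he' hne hcr => ?_
    rw [Finset.mem_sdiff] at he he'
    refine he.2 (Finset.mem_image.2 ⟨(e, e'), ?_, rfl⟩)
    simp [hX, he.1, he'.1, hne, hcr]
  have h2 := Finset.card_le_card_sdiff_add_card (s := T) (t := X.image Prod.fst)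
  have h3 : (X.image Prod.fst).card ≤ X.card := Finset.card_image_le
  omega

/-- The number of colourings in which all elements of `A` get the colour `0`. -/
theorem card_colourings {α : Type*} [Fintype α] [DecidableEq α] (k : ℕ) (A : Finset α) :
    (Finset.univ.filter fun c : α → Fin (k + 1) => ∀ a ∈ A, c a = 0).card * (k + 1) ^ A.card =
      (k + 1) ^ Fintype.card α := by
  have h : (Finset.univ.filter fun c : α → Fin (k + 1) => ∀ a ∈ A, c a = 0) =
      Fintype.piFinset fun a => if a ∈ A then {0} else Finset.univ := by
    ext c
    simp only [Finset.mem_filter, Finset.mem_univ, true_and, Fintype.mem_piFinset]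
    refine forall_congr' fun a => ?_
    by_cases ha : a ∈ A <;> simp [ha]
  have h2 : ∀ a, (if a ∈ A then ({0} : Finset (Fin (k + 1))) else Finset.univ).card =
      if a ∈ A then 1 else k + 1 := by
    intro a
    by_cases ha : a ∈ A <;> simp [ha]
  rw [h, Fintype.card_piFinset]
  simp only [h2]
  rw [Finset.prod_ite]
  simp only [Finset.prod_const, one_pow, one_mul]
  rw [← pow_add]
  congr 1
  have h3 : (Finset.univ.filter fun a => a ∉ A) = Aᶜ := by ext; simp
  rw [h3, Finset.card_compl, Nat.sub_add_cancel (Finset.card_le_univ A)]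

/-- Amplification of a linear crossing bound by sampling the vertices with probability
`1 / (k + 1)`. -/
theorem amplify_crossing_bound {α ε : Type*} [Fintype α] [DecidableEq α] (k : ℕ) (T : Finset ε) (l r : ε → α)
    (X : Finset (ε × ε)) (hT : ∀ e ∈ T, l e ≠ r e)
    (hX : ∀ z ∈ X, ({l z.1, r z.1, l z.2, r z.2} : Finset α).card = 4)
    (hW : ∀ W : Finset α, (T.filter fun e => l e ∈ W ∧ r e ∈ W).card ≤ 3 * W.card +
      (X.filter fun z => l z.1 ∈ W ∧ r z.1 ∈ W ∧ l z.2 ∈ W ∧ r z.2 ∈ W).card) :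
    (k + 1) ^ 2 * T.card ≤ 3 * (k + 1) ^ 3 * Fintype.card α + X.card := by
  -- The colour class of `0` is a random vertex set, with sums over colourings in place of
  -- expectations. A vertex, an arc and a crossing survive in proportions (k+1)^(-1), (k+1)^(-2) and
  -- (k+1)^(-4), the last because the four ends are distinct.
  let W : (α → Fin (k + 1)) → Finset α := fun c => Finset.univ.filter fun a => c a = 0
  have hsum := Finset.sum_le_sum fun c (_ : c ∈ Finset.univ) => hW (W c)
  rw [Finset.sum_add_distrib, ← Finset.mul_sum] at hsum
  have hcol := card_colourings (α := α) k
  set M := (k + 1) ^ Fintype.card α with hM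
  have e1 : (∑ c, (T.filter fun e => l e ∈ W c ∧ r e ∈ W c).card) * (k + 1) ^ 2 = T.card * M := by
    simp_rw [Finset.card_filter]
    rw [Finset.sum_comm, Finset.sum_mul, Finset.card_eq_sum_ones, Finset.sum_mul]
    refine Finset.sum_congr rfl fun e he => ?_
    rw [← Finset.card_filter, one_mul, ← hcol {l e, r e}, Finset.card_pair (hT e he)]
    congr 2
    ext c
    simp [W]
  have e2 : (∑ c, (W c).card) * (k + 1) = Fintype.card α * M := by
    simp_rw [W, Finset.card_filter]
    rw [Finset.sum_comm, Finset.sum_mul, ← Finset.card_univ, Finset.card_eq_sum_ones,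
      Finset.sum_mul]
    refine Finset.sum_congr rfl fun a _ => ?_
    rw [← Finset.card_filter, one_mul, ← hcol {a}, Finset.card_singleton, pow_one]
    congr 2
    ext c
    simp
  have e3 : (∑ c, (X.filter fun z => l z.1 ∈ W c ∧ r z.1 ∈ W c ∧ l z.2 ∈ W c ∧ r z.2 ∈ W c).card)
      * (k + 1) ^ 4 = X.card * M := by
    simp_rw [Finset.card_filter]
    rw [Finset.sum_comm, Finset.sum_mul, Finset.card_eq_sum_ones, Finset.sum_mul]
    refine Finset.sum_congr rfl fun z hz => ?_
    rw [← Finset.card_filter, one_mul, ← hcol {l z.1, r z.1, l z.2, r z.2}, hX z hz]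
    congr 2
    ext c
    simp [W]
  have hMpos : 0 < M := by positivity
  refine Nat.le_of_mul_le_mul_right ?_ hMpos
  calc (k + 1) ^ 2 * T.card * M = (k + 1) ^ 2 * (T.card * M) := by ring
    _ = (∑ c, (T.filter fun e => l e ∈ W c ∧ r e ∈ W c).card) * (k + 1) ^ 4 := by rw [← e1]; ring
    _ ≤ (3 * (∑ c, (W c).card) + (∑ c, (X.filter fun z => l z.1 ∈ W c ∧ r z.1 ∈ W c ∧
        l z.2 ∈ W c ∧ r z.2 ∈ W c).card)) * (k + 1) ^ 4 := Nat.mul_le_mul_right _ hsum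
    _ = 3 * (k + 1) ^ 3 * ((∑ c, (W c).card) * (k + 1)) + (∑ c, (X.filter fun z => l z.1 ∈ W c ∧
        r z.1 ∈ W c ∧ l z.2 ∈ W c ∧ r z.2 ∈ W c).card) * (k + 1) ^ 4 := by ring
    _ = (3 * (k + 1) ^ 3 * Fintype.card α + X.card) * M := by rw [e2, e3]; ring

/-! ### The Szemerédi–Trotter bound -/

open Classical in
/-- The Szemerédi–Trotter bound, before optimising `k`, for finitely many points and finitely many
`x`-monotone curves any two of which meet at most once. -/
theorem incidences_le {ι : Type*} (k : ℕ) (C : Finset ι) (P : Finset (ℝ × ℝ)) (D : ι → Set ℝ)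
    (f : ι → ℝ → ℝ) (hD : ∀ c ∈ C, (D c).OrdConnected) (hf : ∀ c ∈ C, Continuous (f c))
    (hpseudo : ∀ c ∈ C, ∀ c' ∈ C, c ≠ c' → ∀ x y, x ∈ D c → x ∈ D c' → y ∈ D c → y ∈ D c' →
      f c x = f c' x → f c y = f c' y → x = y) :
    (k + 1) ^ 2 * ((C ×ˢ P).filter fun z => z.2.1 ∈ D z.1 ∧ f z.1 z.2.1 = z.2.2).card ≤
      (k + 1) ^ 2 * C.card + 3 * (k + 1) ^ 3 * P.card + C.card ^ 2 := by
  set I := (C ×ˢ P).filter fun z => z.2.1 ∈ D z.1 ∧ f z.1 z.2.1 = z.2.2 with hI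
  let On : ι → ℝ × ℝ → Prop := fun c p => p.1 ∈ D c ∧ f c p.1 = p.2
  -- Arcs join consecutive points of `P` along one curve.
  let T : Finset (ι × P × P) := (C ×ˢ Finset.univ).filter fun e =>
    On e.1 e.2.1 ∧ On e.1 e.2.2 ∧ e.2.1.1.1 < e.2.2.1.1 ∧
      ∀ p ∈ P, On e.1 p → e.2.1.1.1 < p.1 → e.2.2.1.1 ≤ p.1
  have hT : ∀ e : ι × P × P, e ∈ T ↔ e.1 ∈ C ∧ On e.1 e.2.1 ∧ On e.1 e.2.2 ∧
      e.2.1.1.1 < e.2.2.1.1 ∧ ∀ p ∈ P, On e.1 p → e.2.1.1.1 < p.1 → e.2.2.1.1 ≤ p.1 := by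
    intro e
    simp [T]
  let l : ι × P × P → ℝ × ℝ := fun e => e.2.1
  let r : ι × P × P → ℝ × ℝ := fun e => e.2.2
  let g : ι × P × P → ℝ → ℝ := fun e => f e.1
  have hdom : ∀ e ∈ T, ∀ x, (l e).1 ≤ x → x ≤ (r e).1 → x ∈ D e.1 := by
    intro e he x h1 h2
    obtain ⟨hc, h3, h4, -⟩ := (hT e).1 he
    exact (hD _ hc).out h3.1 h4.1 ⟨h1, h2⟩
  have onext : ∀ c (p q : ℝ × ℝ), On c p → On c q → p.1 = q.1 → p = q := by
    intro c p q hp hq h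
    exact Prod.ext h (by rw [← hp.2, ← hq.2, h])
  -- two edges on the same curve have disjoint interiors
  have same : ∀ e ∈ T, ∀ e' ∈ T, e.1 = e'.1 → ∀ x, (l e).1 < x → x < (r e).1 → (l e').1 < x →
      x < (r e').1 → e = e' := by
    intro e he e' he' hc x h1 h2 h3 h4
    obtain ⟨hC, a1, a2, a3, a4⟩ := (hT e).1 he
    obtain ⟨hC', b1, b2, b3, b4⟩ := (hT e').1 he'
    rw [← hc] at b1 b2 b4
    have hl : e.2.1.1.1 = e'.2.1.1.1 := by
      apply le_antisymm
      · by_contra hcon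
        push Not at hcon
        have := b4 _ e.2.1.2 a1 hcon
        simp only [l, r] at *
        linarith
      · by_contra hcon
        push Not at hcon
        have := a4 _ e'.2.1.2 b1 hcon
        simp only [l, r] at *
        linarith
    have hr : e.2.2.1.1 = e'.2.2.1.1 :=
      le_antisymm (a4 _ e'.2.2.2 b2 (hl ▸ b3)) (b4 _ e.2.2.2 a2 (hl ▸ a3))
    exact Prod.ext hc (Prod.ext (Subtype.ext (onext _ _ _ a1 b1 hl))
      (Subtype.ext (onext _ _ _ a2 b2 hr)))
  have hsys : IsArcSystem P T l r g := by
    refine ⟨fun e he => hf _ ((hT e).1 he).1, fun e he => ((hT e).1 he).2.2.2.1,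
      fun e he => ((hT e).1 he).2.1.2, fun e he => ((hT e).1 he).2.2.1.2,
      fun e _ => e.2.1.2, fun e _ => e.2.2.2, ?_, ?_⟩
    · intro e he p hp h1 h2 h3
      have := ((hT e).1 he).2.2.2.2 p hp ⟨hdom e he _ h1.le h2.le, h3⟩ h1
      exact absurd h2 (not_lt.2 this)
    · intro e he e' he' h1 h2
      obtain ⟨hC, a1, a2, a3, a4⟩ := (hT e).1 he
      obtain ⟨hC', b1, b2, b3, b4⟩ := (hT e').1 he'
      simp only [l, r] at h1 h2
      rw [← h1] at b1
      rw [← h2] at b2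
      have hc : e.1 = e'.1 := by
        by_contra hne
        exact absurd (hpseudo _ hC _ hC' hne _ _ a1.1 b1.1 a2.1 b2.1 (a1.2.trans b1.2.symm)
          (a2.2.trans b2.2.symm)) a3.ne
      exact Prod.ext hc (Prod.ext (Subtype.ext h1) (Subtype.ext h2))
  set X := (T ×ˢ T).filter fun z => z.1 ≠ z.2 ∧ ArcsCross l r g z.1 z.2 with hX
  have hXmem : ∀ z ∈ X, z.1 ∈ T ∧ z.2 ∈ T ∧ z.1.1 ≠ z.2.1 ∧ ArcsCross l r g z.1 z.2 := by
    intro z hz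
    simp only [hX, Finset.mem_filter, Finset.mem_product] at hz
    obtain ⟨⟨h1, h2⟩, hne, hcr⟩ := hz
    refine ⟨h1, h2, fun hc => hne ?_, hcr⟩
    obtain ⟨x, a1, a2, a3, a4, -⟩ := hcr
    exact same _ h1 _ h2 hc x a1 a2 a3 a4
  have hXcard : X.card ≤ C.card ^ 2 := by
    rw [sq, ← Finset.card_product]
    -- Two curves meet at one abscissa at most, and on each curve that abscissa lies inside at most
    -- one arc; so the pair of curves determines the crossing.
    refine Finset.card_le_card_of_injOn (fun z => (z.1.1, z.2.1)) (fun z hz => ?_) ?_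
    · obtain ⟨h1, h2, -, -⟩ := hXmem z hz
      exact Finset.mem_coe.2 (Finset.mem_product.2 ⟨((hT _).1 h1).1, ((hT _).1 h2).1⟩)
    · intro z hz z' hz' h
      obtain ⟨h1, h2, hne, x, a1, a2, a3, a4, a5⟩ := hXmem z hz
      obtain ⟨h1', h2', hne', x', b1, b2, b3, b4, b5⟩ := hXmem z' hz'
      simp only [Prod.mk.injEq] at h
      have hxx : x = x' := by
        refine hpseudo _ ((hT _).1 h1).1 _ ((hT _).1 h2).1 hne x x'
          (hdom _ h1 _ a1.le a2.le) (hdom _ h2 _ a3.le a4.le) ?_ ?_ a5 ?_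
        · rw [h.1]; exact hdom _ h1' _ b1.le b2.le
        · rw [h.2]; exact hdom _ h2' _ b3.le b4.le
        · rw [h.1, h.2]; exact b5
      subst hxx
      exact Prod.ext (same _ h1 _ h1' h.1 x a1 a2 b1 b2) (same _ h2 _ h2' h.2 x a3 a4 b3 b4)
  have hbound : (k + 1) ^ 2 * T.card ≤ 3 * (k + 1) ^ 3 * P.card + X.card := by
    have hTne : ∀ e ∈ T, e.2.1 ≠ e.2.2 := by
      intro e he h
      have := ((hT e).1 he).2.2.2.1
      rw [h] at this
      exact lt_irrefl _ this
    have := amplify_crossing_bound k T (fun e => e.2.1) (fun e => e.2.2) X hTne ?_ ?_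
    · simpa using this
    · intro z hz
      obtain ⟨h1, h2, hne, x, a1, a2, a3, a4, a5⟩ := hXmem z hz
      -- A common end of two crossing arcs would be a second meeting point of their curves.
      have key : ∀ p : ℝ × ℝ, On z.1.1 p → On z.2.1 p → p.1 = x := fun p hp hq =>
        hpseudo _ ((hT _).1 h1).1 _ ((hT _).1 h2).1 hne _ _ hp.1 hq.1
          (hdom _ h1 _ a1.le a2.le) (hdom _ h2 _ a3.le a4.le) (hp.2.trans hq.2.symm) a5
      obtain ⟨-, c1, c2, -, -⟩ := (hT _).1 h1
      obtain ⟨-, d1, d2, -, -⟩ := (hT _).1 h2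
      have n1 := hTne _ h1
      have n2 : z.1.2.1 ≠ z.2.2.1 := fun h => a1.ne (key z.1.2.1 c1 (by rw [h]; exact d1))
      have n3 : z.1.2.1 ≠ z.2.2.2 := fun h => a1.ne (key z.1.2.1 c1 (by rw [h]; exact d2))
      have n4 : z.1.2.2 ≠ z.2.2.1 := fun h => a2.ne' (key z.1.2.2 c2 (by rw [h]; exact d1))
      have n5 : z.1.2.2 ≠ z.2.2.2 := fun h => a2.ne' (key z.1.2.2 c2 (by rw [h]; exact d2))
      have n6 := hTne _ h2
      rw [Finset.card_insert_of_notMem (by simp [n1, n2, n3]),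
        Finset.card_insert_of_notMem (by simp [n4, n5]), Finset.card_pair n6]
    · intro W
      have hsub : IsArcSystem (W.map (Function.Embedding.subtype _))
          (T.filter fun e => e.2.1 ∈ W ∧ e.2.2 ∈ W) l r g := by
        have hm := hsys.mono (Finset.filter_subset (fun e => e.2.1 ∈ W ∧ e.2.2 ∈ W) T)
        refine { hm with left_mem := ?_, right_mem := ?_, clean := ?_ }
        · intro e he
          exact Finset.mem_map_of_mem (Function.Embedding.subtype _) (Finset.mem_filter.1 he).2.1
        · intro e he
          exact Finset.mem_map_of_mem (Function.Embedding.subtype _) (Finset.mem_filter.1 he).2.2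
        · intro e he p hp
          obtain ⟨q, -, rfl⟩ := Finset.mem_map.1 hp
          exact hm.clean e he _ q.2
      refine (card_arcs_le hsub).trans ?_
      rw [Finset.card_map]
      refine Nat.add_le_add_left (Finset.card_le_card fun z hz => ?_) _
      simp only [hX, Finset.mem_filter, Finset.mem_product] at hz ⊢
      tauto
  have hIcard : I.card ≤ C.card + T.card := by
    -- An incidence is either the last one on its curve or the left end of an arc to the next point.
    have hcov : I ⊆ (I.filter fun z => ∀ q ∈ P, On z.1 q → q.1 ≤ z.2.1) ∪
        T.image fun e => (e.1, e.2.1.1) := by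
      intro z hz
      have hz' := hz
      simp only [hI, Finset.mem_filter, Finset.mem_product] at hz'
      obtain ⟨⟨hc, hp⟩, hon⟩ := hz'
      rw [Finset.mem_union, Finset.mem_filter]
      by_cases hlast : ∀ q ∈ P, On z.1 q → q.1 ≤ z.2.1
      · exact Or.inl ⟨hz, hlast⟩
      · right
        push Not at hlast
        obtain ⟨q, hq, hq1, hq2⟩ := hlast
        obtain ⟨q', hq', hmin⟩ := Finset.exists_min_image
          (P.filter fun q => On z.1 q ∧ z.2.1 < q.1) (fun q => q.1)
          ⟨q, Finset.mem_filter.2 ⟨hq, hq1, hq2⟩⟩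
        obtain ⟨h1, h2, h3⟩ := Finset.mem_filter.1 hq'
        refine Finset.mem_image.2 ⟨(z.1, ⟨z.2, hp⟩, ⟨q', h1⟩), (hT _).2 ⟨hc, hon, h2, h3, ?_⟩, rfl⟩
        intro p hp' hp1 hp2
        exact hmin p (Finset.mem_filter.2 ⟨hp', hp1, hp2⟩)
    have hlast : (I.filter fun z => ∀ q ∈ P, On z.1 q → q.1 ≤ z.2.1).card ≤ C.card := by
      refine Finset.card_le_card_of_injOn Prod.fst (fun z hz => ?_) ?_
      · simp only [hI, Finset.coe_filter, Set.mem_ofPred_eq, Finset.mem_filter,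
          Finset.mem_product] at hz
        exact hz.1.1.1
      · intro z hz z' hz' h
        simp only [hI, Finset.coe_filter, Set.mem_ofPred_eq, Finset.mem_filter,
          Finset.mem_product] at hz hz'
        obtain ⟨⟨⟨h1, h2⟩, h3⟩, h4⟩ := hz
        obtain ⟨⟨⟨h1', h2'⟩, h3'⟩, h4'⟩ := hz'
        have h3'' : On z.1 z'.2 := by rw [h]; exact h3'
        have h3''' : On z'.1 z.2 := by rw [← h]; exact h3
        exact Prod.ext h (onext _ _ _ h3 h3'' (le_antisymm (h4' _ h2 h3''') (h4 _ h2' h3'')))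
    have h1 := Finset.card_le_card hcov
    have h2 := Finset.card_union_le (I.filter fun z => ∀ q ∈ P, On z.1 q → q.1 ≤ z.2.1)
      (T.image fun e => (e.1, e.2.1.1))
    have h3 : (T.image fun e => (e.1, e.2.1.1)).card ≤ T.card := Finset.card_image_le
    omega
  calc (k + 1) ^ 2 * I.card ≤ (k + 1) ^ 2 * (C.card + T.card) := Nat.mul_le_mul_left _ hIcard
    _ = (k + 1) ^ 2 * C.card + (k + 1) ^ 2 * T.card := by ring
    _ ≤ _ := by omega

open Classical in
/-- The Szemerédi–Trotter bound for `n` points and `n` curves. -/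
theorem incidences_le_rpow {ι : Type*} {n : ℕ} (C : Finset ι) (P : Finset (ℝ × ℝ))
    (D : ι → Set ℝ) (f : ι → ℝ → ℝ) (hC : C.card ≤ n) (hP : P.card ≤ n)
    (hD : ∀ c ∈ C, (D c).OrdConnected) (hf : ∀ c ∈ C, Continuous (f c))
    (hpseudo : ∀ c ∈ C, ∀ c' ∈ C, c ≠ c' → ∀ x y, x ∈ D c → x ∈ D c' → y ∈ D c → y ∈ D c' →
      f c x = f c' x → f c y = f c' y → x = y) :
    (((C ×ˢ P).filter fun z => z.2.1 ∈ D z.1 ∧ f z.1 z.2.1 = z.2.2).card : ℝ) ≤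
      8 * (n : ℝ) ^ (4 / 3 : ℝ) := by
  rcases Nat.eq_zero_or_pos n with rfl | hn
  · have : C = ∅ := by simpa using hC
    subst this
    simp
  set a : ℝ := (n : ℝ) ^ (1 / 3 : ℝ) with ha
  have hn1 : (1 : ℝ) ≤ n := by exact_mod_cast hn
  have ha1 : 1 ≤ a := Real.one_le_rpow hn1 (by norm_num)
  have ha3 : a ^ 3 = n := by
    rw [ha, ← Real.rpow_natCast, ← Real.rpow_mul (by positivity)]
    norm_num
  have ha4 : (n : ℝ) ^ (4 / 3 : ℝ) = a ^ 4 := by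
    rw [ha, ← Real.rpow_natCast, ← Real.rpow_mul (by positivity)]
    norm_num
  -- With k + 1 of order n^(1/3), the terms (k+1)n and n^2/(k+1)^2 balance. The three terms
  -- contribute 1, 6 and 1 to the constant 8.
  obtain ⟨k, hk1, hk2⟩ : ∃ k : ℕ, (k : ℝ) ≤ a ∧ a < k + 1 :=
    ⟨⌊a⌋₊, Nat.floor_le (by positivity), Nat.lt_floor_add_one a⟩
  have h := incidences_le k C P D f hD hf hpseudo
  set I := ((C ×ˢ P).filter fun z => z.2.1 ∈ D z.1 ∧ f z.1 z.2.1 = z.2.2).card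
  have h' : ((k : ℝ) + 1) ^ 2 * I ≤ (k + 1) ^ 2 * C.card + 3 * (k + 1) ^ 3 * P.card +
      (C.card : ℝ) ^ 2 := by exact_mod_cast h
  have hC' : (C.card : ℝ) ≤ a ^ 3 := by rw [ha3]; exact_mod_cast hC
  have hP' : (P.card : ℝ) ≤ a ^ 3 := by rw [ha3]; exact_mod_cast hP
  rw [ha4]
  have hb : (0 : ℝ) < ((k : ℝ) + 1) ^ 2 := by positivity
  refine le_of_mul_le_mul_left ?_ hb
  have t1 : ((k : ℝ) + 1) ^ 2 * C.card ≤ (k + 1) ^ 2 * a ^ 4 :=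
    mul_le_mul_of_nonneg_left (hC'.trans (pow_le_pow_right₀ ha1 (by norm_num))) hb.le
  have t2 : 3 * ((k : ℝ) + 1) ^ 3 * P.card ≤ 6 * (k + 1) ^ 2 * a ^ 4 := by
    calc 3 * ((k : ℝ) + 1) ^ 3 * P.card ≤ 3 * ((k : ℝ) + 1) ^ 3 * a ^ 3 := by gcongr
      _ = 3 * ((k : ℝ) + 1) ^ 2 * a ^ 3 * (k + 1) := by ring
      _ ≤ 3 * ((k : ℝ) + 1) ^ 2 * a ^ 3 * (2 * a) := by gcongr; linarith
      _ = _ := by ring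
  have t3 : (C.card : ℝ) ^ 2 ≤ (k + 1) ^ 2 * a ^ 4 := by
    calc (C.card : ℝ) ^ 2 ≤ (a ^ 3) ^ 2 := by gcongr
      _ = a ^ 2 * a ^ 4 := by ring
      _ ≤ _ := by gcongr
  linarith

open Classical in
/-- The Szemerédi–Trotter bound for curves indexed by points of the plane. -/
theorem plane_incidences_le {n : ℕ} (C E : Finset Plane) (D : Plane → Set ℝ)
    (f : Plane → ℝ → ℝ) (hC : C.card ≤ n) (hE : E.card ≤ n)
    (hD : ∀ c ∈ C, (D c).OrdConnected) (hf : ∀ c ∈ C, Continuous (f c))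
    (hpseudo : ∀ c ∈ C, ∀ c' ∈ C, c ≠ c' → ∀ x y, x ∈ D c → x ∈ D c' → y ∈ D c → y ∈ D c' →
      f c x = f c' x → f c y = f c' y → x = y) (U : Finset (Plane × Plane))
    (hU : ∀ z ∈ U, z.1 ∈ C ∧ z.2 ∈ E ∧ z.2 0 ∈ D z.1 ∧ f z.1 (z.2 0) = z.2 1) :
    (U.card : ℝ) ≤ 8 * (n : ℝ) ^ (4 / 3 : ℝ) := by
  refine le_trans ?_ (incidences_le_rpow C (E.image fun q => (q 0, q 1)) D f hC
    (Finset.card_image_le.trans hE) hD hf hpseudo)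
  rw [Nat.cast_le]
  refine Finset.card_le_card_of_injOn (fun z => (z.1, (z.2 0, z.2 1))) (fun z hz => ?_) ?_
  · obtain ⟨h1, h2, h3⟩ := hU z hz
    simp only [Finset.coe_filter, Set.mem_ofPred_eq, Finset.mem_product]
    exact ⟨⟨h1, Finset.mem_image_of_mem _ h2⟩, h3⟩
  · intro z _ z' _ h
    simp only [Prod.mk.injEq] at h
    refine Prod.ext h.1 ?_
    ext i
    fin_cases i
    · exact h.2.1
    · exact h.2.2

/-! ### Repeated distances and dot products -/

theorem dist_sq_eq (p q : Plane) : dist p q ^ 2 = (q 0 - p 0) ^ 2 + (q 1 - p 1) ^ 2 := by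
  rw [EuclideanSpace.dist_eq, Real.sq_sqrt (by positivity), Fin.sum_univ_two, Real.dist_eq,
    Real.dist_eq, sq_abs, sq_abs]
  ring

theorem inner_eq (p q : Plane) : inner ℝ p q = p 0 * q 0 + p 1 * q 1 := by
  simp only [PiLp.inner_apply, Fin.sum_univ_two, RCLike.inner_apply, conj_trivial]
  ring

/-- Two upper half circles of the same radius with different centres meet at most once. -/
theorem upper_half_circles_meet_once {a b a' b' x X y Y r : ℝ}
    (h1 : (x - a) ^ 2 + (X - b) ^ 2 = r ^ 2) (h2 : (x - a') ^ 2 + (X - b') ^ 2 = r ^ 2)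
    (h3 : (y - a) ^ 2 + (Y - b) ^ 2 = r ^ 2) (h4 : (y - a') ^ 2 + (Y - b') ^ 2 = r ^ 2)
    (g1 : b ≤ X) (g2 : b' ≤ X) (g3 : b ≤ Y) (g4 : b' ≤ Y) (hne : ¬ (a = a' ∧ b = b')) :
    x = y := by
  by_contra hxy
  -- Doubled displacements of the two common points from the midpoint of the centres: both are
  -- orthogonal to the line of centres, and they have equal length.
  have u : (a' - a) * (2 * x - (a + a')) + (b' - b) * (2 * X - (b + b')) = 0 := by linarith
  have v : (a' - a) * (2 * y - (a + a')) + (b' - b) * (2 * Y - (b + b')) = 0 := by linarith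
  have huv : (2 * x - (a + a')) ^ 2 + (2 * X - (b + b')) ^ 2 =
      (2 * y - (a + a')) ^ 2 + (2 * Y - (b + b')) ^ 2 := by linarith
  generalize hu0 : 2 * x - (a + a') = u0 at *
  generalize hu1 : 2 * X - (b + b') = u1 at *
  generalize hv0 : 2 * y - (a + a') = v0 at *
  generalize hv1 : 2 * Y - (b + b') = v1 at *
  have hcr : u0 * v1 - u1 * v0 = 0 := by
    by_contra hcon
    apply hne
    constructor
    · have : (a' - a) * (u0 * v1 - u1 * v0) = 0 := by linear_combination v1 * u - u1 * v
      rcases mul_eq_zero.1 this with h | h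
      · linarith
      · exact absurd h hcon
    · have : (b' - b) * (u0 * v1 - u1 * v0) = 0 := by linear_combination u0 * v - v0 * u
      rcases mul_eq_zero.1 this with h | h
      · linarith
      · exact absurd h hcon
  -- Parallel vectors of equal length agree up to sign: |u-v|^2 |u+v|^2 = (|u|^2-|v|^2)^2 + 4
  -- det(u,v)^2.
  have hprod : ((u0 - v0) ^ 2 + (u1 - v1) ^ 2) * ((u0 + v0) ^ 2 + (u1 + v1) ^ 2) = 0 := by
    linear_combination (u0 ^ 2 + u1 ^ 2 - v0 ^ 2 - v1 ^ 2) * huv + 4 * (u0 * v1 - u1 * v0) * hcr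
  rcases mul_eq_zero.1 hprod with h | h
  · have := pow_eq_zero_iff two_ne_zero |>.1
      ((add_eq_zero_iff_of_nonneg (sq_nonneg _) (sq_nonneg _)).1 h).1
    apply hxy
    linarith
  -- If u = -v, then X + Y = b + b', so the half-circle inequalities are all equalities and (x+y)/2
  -- is the abscissa of both centres.
  · obtain ⟨e0, e1⟩ := (add_eq_zero_iff_of_nonneg (sq_nonneg _) (sq_nonneg _)).1 h
    rw [pow_eq_zero_iff two_ne_zero] at e0 e1
    have hXb : X = b := by linarith
    have hbb : b = b' := by linarith
    have hYb : Y = b := by linarith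
    subst hXb hYb hbb
    have k1 : (x - y) * (x + y - 2 * a) = 0 := by linear_combination h1 - h3
    have k2 : (x - y) * (x + y - 2 * a') = 0 := by linear_combination h2 - h4
    have hxy' : x - y ≠ 0 := sub_ne_zero.2 hxy
    refine hne ⟨?_, rfl⟩
    have := (mul_eq_zero.1 k1).resolve_left hxy'
    have := (mul_eq_zero.1 k2).resolve_left hxy'
    linarith

open Classical in
/-- The Spencer–Szemerédi–Trotter bound on repeated distances. -/
theorem card_pairs_dist_le (E : Finset Plane) (r : ℝ) :
    (((E ×ˢ E).filter fun z => z.1 ≠ z.2 ∧ dist z.1 z.2 = r).card : ℝ) ≤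
      16 * (E.card : ℝ) ^ (4 / 3 : ℝ) := by
  set S := (E ×ˢ E).filter fun z => z.1 ≠ z.2 ∧ dist z.1 z.2 = r
  let f : Plane → ℝ → ℝ := fun p x => p 1 + √(r ^ 2 - (x - p 0) ^ 2)
  set U := (E ×ˢ E).filter fun z =>
    z.2 0 ∈ Set.Icc (z.1 0 - r) (z.1 0 + r) ∧ f z.1 (z.2 0) = z.2 1 with hU
  have hcirc : ∀ p : Plane, ∀ x ∈ Set.Icc (p 0 - r) (p 0 + r),
      (x - p 0) ^ 2 + (f p x - p 1) ^ 2 = r ^ 2 ∧ p 1 ≤ f p x := by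
    intro p x hx
    have h0 : 0 ≤ r ^ 2 - (x - p 0) ^ 2 := by nlinarith [hx.1, hx.2]
    refine ⟨?_, le_add_of_nonneg_right (Real.sqrt_nonneg _)⟩
    simp only [f, add_sub_cancel_left]
    rw [Real.sq_sqrt h0]
    ring
  have hUcard : (U.card : ℝ) ≤ 8 * (E.card : ℝ) ^ (4 / 3 : ℝ) := by
    refine plane_incidences_le E E (fun p => Set.Icc (p 0 - r) (p 0 + r)) f le_rfl le_rfl
      (fun _ _ => Set.ordConnected_Icc) (fun p _ => by fun_prop) ?_ U fun z hz => by
        simpa only [hU, Finset.mem_filter, Finset.mem_product, and_assoc] using hz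
    intro c _ c' _ hne x y hx hx' hy hy' hfx hfy
    have h1 := hcirc c x hx
    have h2 := hcirc c' x hx'
    have h3 := hcirc c y hy
    have h4 := hcirc c' y hy'
    rw [← hfx] at h2
    rw [← hfy] at h4
    refine upper_half_circles_meet_once h1.1 h2.1 h3.1 h4.1 h1.2 h2.2 h3.2 h4.2 fun h => hne ?_
    ext i
    fin_cases i
    · exact h.1
    · exact h.2
  have hup : ∀ p ∈ E, ∀ q ∈ E, dist p q = r → p 1 ≤ q 1 → (p, q) ∈ U := by
    intro p hp q hq hd hle
    have hr : 0 ≤ r := hd ▸ dist_nonneg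
    have hsq := dist_sq_eq p q
    rw [hd] at hsq
    have habs : |q 0 - p 0| ≤ r := abs_le_of_sq_le_sq (by nlinarith [sq_nonneg (q 1 - p 1)]) hr
    rw [abs_le] at habs
    simp only [hU, Finset.mem_filter, Finset.mem_product]
    refine ⟨⟨hp, hq⟩, ⟨by linarith [habs.1], by linarith [habs.2]⟩, ?_⟩
    have : r ^ 2 - (q 0 - p 0) ^ 2 = (q 1 - p 1) ^ 2 := by linarith
    simp only [f]
    rw [this, Real.sqrt_sq (by linarith)]
    ring
  -- If `q` is on the lower half circle about `p`, then `p` is on the upper one about `q`; this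
  -- doubles the constant 8.
  have hS : S ⊆ U ∪ U.image Prod.swap := by
    rintro ⟨p, q⟩ hz
    simp only [S, Finset.mem_filter, Finset.mem_product] at hz
    obtain ⟨⟨hp, hq⟩, -, hd⟩ := hz
    rw [Finset.mem_union]
    rcases le_total (p 1) (q 1) with h | h
    · exact Or.inl (hup p hp q hq hd h)
    · exact Or.inr (Finset.mem_image.2 ⟨(q, p), hup q hq p hp (by rw [dist_comm, hd]) h, rfl⟩)
  have h1 : S.card ≤ 2 * U.card := by
    have := Finset.card_le_card hS
    have := Finset.card_union_le U (U.image Prod.swap)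
    have : (U.image Prod.swap).card ≤ U.card := Finset.card_image_le
    omega
  have h2 : (S.card : ℝ) ≤ 2 * U.card := by exact_mod_cast h1
  linarith

open Classical in
/-- The Szemerédi–Trotter bound on repeated nonzero dot products. -/
theorem card_pairs_inner_le (E : Finset Plane) {a : ℝ} (ha : a ≠ 0) :
    (((E ×ˢ E).filter fun z => z.1 ≠ z.2 ∧ inner ℝ z.1 z.2 = a).card : ℝ) ≤
      16 * (E.card : ℝ) ^ (4 / 3 : ℝ) := by
  set S := (E ×ˢ E).filter fun z => z.1 ≠ z.2 ∧ inner ℝ z.1 z.2 = a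
  set C := E.filter fun p => p 1 ≠ 0
  let f : Plane → ℝ → ℝ := fun p x => (a - p 0 * x) / p 1
  set U := (C ×ˢ E).filter fun z => z.2 0 ∈ Set.univ ∧ f z.1 (z.2 0) = z.2 1 with hU
  -- The vertical lines are kept apart: for `p` on the horizontal axis, `q` forces `p 0 = a / q 0`,
  -- so there are at most |E| such pairs.
  set W := (E ×ˢ E).filter fun z => z.1 1 = 0 ∧ inner ℝ z.1 z.2 = a with hW
  have hUcard : (U.card : ℝ) ≤ 8 * (E.card : ℝ) ^ (4 / 3 : ℝ) := by
    refine plane_incidences_le C E (fun _ => Set.univ) f (Finset.card_filter_le _ _) le_rfl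
      (fun _ _ => Set.ordConnected_univ) (fun p _ => by fun_prop) ?_ U fun z hz => by
        simpa only [hU, Finset.mem_filter, Finset.mem_product, and_assoc] using hz
    intro c hc c' hc' hne x y _ _ _ _ hfx hfy
    have hc1 : c 1 ≠ 0 := (Finset.mem_filter.1 hc).2
    have hc1' : c' 1 ≠ 0 := (Finset.mem_filter.1 hc').2
    simp only [f] at hfx hfy
    rw [div_eq_div_iff hc1 hc1'] at hfx hfy
    by_contra hxy
    have hxy' : x - y ≠ 0 := sub_ne_zero.2 hxy
    have k1 : (x - y) * (c' 0 * c 1 - c 0 * c' 1) = 0 := by linear_combination hfx - hfy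
    have k2 := (mul_eq_zero.1 k1).resolve_left hxy'
    -- Since `a ≠ 0`, the line of solutions `q` of `⟨c, q⟩ = a` determines `c`.
    have k3 : a * (c' 1 - c 1) = 0 := by linear_combination hfx - x * k2
    have k4 := (mul_eq_zero.1 k3).resolve_left ha
    have k5 : c 1 * (c' 0 - c 0) = 0 := by linear_combination k2 + c 0 * k4
    have k6 := (mul_eq_zero.1 k5).resolve_left hc1
    apply hne
    ext i
    fin_cases i
    · exact (sub_eq_zero.1 k6).symm
    · exact (sub_eq_zero.1 k4).symm
  have hWcard : W.card ≤ E.card := by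
    refine Finset.card_le_card_of_injOn Prod.snd (fun z hz => ?_) ?_
    · simp only [hW, Finset.coe_filter, Set.mem_ofPred_eq, Finset.mem_product] at hz
      exact hz.1.2
    · rintro ⟨p, q⟩ hz ⟨p', q'⟩ hz' h
      simp only [hW, Finset.coe_filter, Set.mem_ofPred_eq, Finset.mem_product, inner_eq] at hz hz' h
      subst h
      obtain ⟨-, h1, h2⟩ := hz
      obtain ⟨-, h1', h2'⟩ := hz'
      rw [h1] at h2
      rw [h1'] at h2'
      have hq : q 0 ≠ 0 := by
        intro hq
        rw [hq] at h2
        apply ha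
        linarith
      have h0 : p 0 = p' 0 := mul_right_cancel₀ hq (by linarith)
      refine Prod.ext ?_ rfl
      ext i
      fin_cases i
      · exact h0
      · exact h1.trans h1'.symm
  have hS : S ⊆ U ∪ W := by
    rintro ⟨p, q⟩ hz
    simp only [S, Finset.mem_filter, Finset.mem_product] at hz
    obtain ⟨⟨hp, hq⟩, -, hd⟩ := hz
    rw [Finset.mem_union]
    by_cases h : p 1 = 0
    · exact Or.inr (Finset.mem_filter.2 ⟨Finset.mem_product.2 ⟨hp, hq⟩, h, hd⟩)
    · refine Or.inl (Finset.mem_filter.2 ⟨Finset.mem_product.2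
        ⟨Finset.mem_filter.2 ⟨hp, h⟩, hq⟩, Set.mem_univ _, ?_⟩)
      rw [inner_eq] at hd
      simp only [f]
      rw [div_eq_iff h]
      linarith
  have h1 : (S.card : ℝ) ≤ U.card + W.card := by
    exact_mod_cast (Finset.card_le_card hS).trans (Finset.card_union_le U W)
  have h2 : (W.card : ℝ) ≤ E.card := by exact_mod_cast hWcard
  have h3 : (E.card : ℝ) ≤ (E.card : ℝ) ^ (4 / 3 : ℝ) := by
    rcases Nat.eq_zero_or_pos E.card with h | h
    · rw [h]
      simp
    · have h' : (1 : ℝ) ≤ E.card := by exact_mod_cast h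
      simpa using Real.rpow_le_rpow_of_exponent_le h' (by norm_num : (1 : ℝ) ≤ 4 / 3)
  have h4 : (0 : ℝ) ≤ (E.card : ℝ) ^ (4 / 3 : ℝ) := by positivity
  linarith

/-! ### Three-point paths -/

-- Once the two ends are fixed, the middle point lies on two circles with distinct centres, leaving
-- at most two choices.
open Classical in
theorem card_triples_dist_le (E : Finset Plane) (a b : ℝ) :
    ((E ×ˢ E ×ˢ E).filter fun z => z.1 ≠ z.2.2 ∧ dist z.1 z.2.1 = a ∧
      dist z.2.1 z.2.2 = b).card ≤ 2 * E.card ^ 2 := by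
  rw [sq, ← Finset.card_product]
  refine Finset.card_le_mul_card_image_of_maps_to (f := fun z => (z.1, z.2.2)) (fun z hz => ?_) 2 ?_
  · simp only [Finset.mem_filter, Finset.mem_product] at hz ⊢
    exact ⟨hz.1.1, hz.1.2.2⟩
  · rintro ⟨p, r⟩ -
    by_contra hcon
    push Not at hcon
    obtain ⟨z₁, h1, z₂, h2, z₃, h3, h12, h13, h23⟩ := Finset.two_lt_card.1 hcon
    obtain ⟨p₁, q₁, r₁⟩ := z₁
    obtain ⟨p₂, q₂, r₂⟩ := z₂
    obtain ⟨p₃, q₃, r₃⟩ := z₃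
    simp only [Finset.mem_filter, Finset.mem_product, Prod.mk.injEq] at h1 h2 h3
    obtain ⟨⟨-, hpr, a1, b1⟩, rfl, rfl⟩ := h1
    obtain ⟨⟨-, -, a2, b2⟩, rfl, rfl⟩ := h2
    obtain ⟨⟨-, -, a3, b3⟩, rfl, rfl⟩ := h3
    have hq : q₁ ≠ q₂ := fun h => h12 (by rw [h])
    rw [dist_comm] at a1 a2 a3
    rcases EuclideanGeometry.eq_of_dist_eq_of_dist_eq_of_finrank_eq_two (by simp) hpr hq
      a1 a2 a3 b1 b2 b3 with h | h
    · exact h13 (by rw [h])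
    · exact h23 (by rw [h])

-- If the ends are linearly independent, they determine the middle point. If they are dependent, the
-- first two points determine the third, because their dot product is nonzero. Each case gives at
-- most |E|^2 triples.
open Classical in
theorem card_triples_inner_le (E : Finset Plane) {a b : ℝ} (ha : a ≠ 0) :
    ((E ×ˢ E ×ˢ E).filter fun z => z.1 ≠ z.2.2 ∧ inner ℝ z.1 z.2.1 = a ∧
      inner ℝ z.2.1 z.2.2 = b).card ≤ 2 * E.card ^ 2 := by
  set S := (E ×ˢ E ×ˢ E).filter fun z => z.1 ≠ z.2.2 ∧ inner ℝ z.1 z.2.1 = a ∧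
      inner ℝ z.2.1 z.2.2 = b with hS
  let Q : Plane × Plane × Plane → Prop := fun z => z.1 0 * z.2.2 1 = z.1 1 * z.2.2 0
  have hmem : ∀ z ∈ S, z.1 ∈ E ∧ z.2.1 ∈ E ∧ z.2.2 ∈ E ∧ z.1 0 * z.2.1 0 + z.1 1 * z.2.1 1 = a ∧
      z.2.1 0 * z.2.2 0 + z.2.1 1 * z.2.2 1 = b := by
    intro z hz
    simp only [hS, Finset.mem_filter, Finset.mem_product, inner_eq] at hz
    tauto
  have h1 : (S.filter Q).card ≤ E.card ^ 2 := by
    rw [sq, ← Finset.card_product]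
    refine Finset.card_le_card_of_injOn (fun z => (z.1, z.2.1)) (fun z hz => ?_) ?_
    · obtain ⟨h1, h2, -⟩ := hmem z (Finset.mem_filter.1 hz).1
      exact Finset.mem_coe.2 (Finset.mem_product.2 ⟨h1, h2⟩)
    · rintro ⟨p, q, r⟩ hz ⟨p', q', r'⟩ hz' h
      obtain ⟨hz, hQ⟩ := Finset.mem_filter.1 hz
      obtain ⟨hz', hQ'⟩ := Finset.mem_filter.1 hz'
      obtain ⟨-, -, -, a1, b1⟩ := hmem _ hz
      obtain ⟨-, -, -, -, b2⟩ := hmem _ hz'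
      simp only [Prod.mk.injEq, Q] at h a1 b1 b2 hQ hQ'
      obtain ⟨rfl, rfl⟩ := h
      -- Cramer's rule: the conditions ⟨q, r⟩ = b and det(p, r) = 0 on `r` form a linear system with
      -- determinant ⟨p, q⟩ = a.
      have k0 : a * (r 0 - r' 0) = 0 := by
        rw [← a1]; linear_combination p 0 * (b1 - b2) - q 1 * (hQ - hQ')
      have k1 : a * (r 1 - r' 1) = 0 := by
        rw [← a1]; linear_combination p 1 * (b1 - b2) + q 0 * (hQ - hQ')
      have hr : r = r' := by
        ext i
        fin_cases i
        · exact sub_eq_zero.1 ((mul_eq_zero.1 k0).resolve_left ha)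
        · exact sub_eq_zero.1 ((mul_eq_zero.1 k1).resolve_left ha)
      rw [hr]
  have h2 : (S.filter fun z => ¬ Q z).card ≤ E.card ^ 2 := by
    rw [sq, ← Finset.card_product]
    refine Finset.card_le_card_of_injOn (fun z => (z.1, z.2.2)) (fun z hz => ?_) ?_
    · obtain ⟨h1, -, h3, -⟩ := hmem z (Finset.mem_filter.1 hz).1
      exact Finset.mem_coe.2 (Finset.mem_product.2 ⟨h1, h3⟩)
    · rintro ⟨p, q, r⟩ hz ⟨p', q', r'⟩ hz' h
      obtain ⟨hz, hQ⟩ := Finset.mem_filter.1 hz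
      obtain ⟨hz', -⟩ := Finset.mem_filter.1 hz'
      obtain ⟨-, -, -, a1, b1⟩ := hmem _ hz
      obtain ⟨-, -, -, a2, b2⟩ := hmem _ hz'
      simp only [Prod.mk.injEq, Q] at h a1 b1 a2 b2 hQ
      obtain ⟨rfl, rfl⟩ := h
      have hQ' : p 0 * r 1 - p 1 * r 0 ≠ 0 := sub_ne_zero.2 hQ
      have k0 : (p 0 * r 1 - p 1 * r 0) * (q 0 - q' 0) = 0 := by
        linear_combination r 1 * (a1 - a2) - p 1 * (b1 - b2)
      have k1 : (p 0 * r 1 - p 1 * r 0) * (q 1 - q' 1) = 0 := by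
        linear_combination p 0 * (b1 - b2) - r 0 * (a1 - a2)
      have hq : q = q' := by
        ext i
        fin_cases i
        · exact sub_eq_zero.1 ((mul_eq_zero.1 k0).resolve_left hQ')
        · exact sub_eq_zero.1 ((mul_eq_zero.1 k1).resolve_left hQ')
      rw [hq]
  have := Finset.card_filter_add_card_filter_not (s := S) Q
  omega

/-! ### Counting configurations through a cover -/

open Classical in
/-- The number of tuples is at most a constant times the number of labelled configurations. -/
theorem tupleCount_isConfiguration_le {V : Type*} [Fintype V] (δ : Plane → Plane → ℝ)
    (G : SimpleGraph V) (w : G.edgeSet → ℝ) (E : Finset Plane) :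
    tupleCount (IsConfiguration δ G w) E ≤ Fintype.card (Fin (Fintype.card V) ≃ V) *
      ((Fintype.piFinset fun _ : V => E).filter fun φ => Function.Injective φ ∧
        ∀ (u v : V) (h : G.Adj u v), δ (φ u) (φ v) = w ⟨s(u, v), G.mem_edgeSet.mpr h⟩).card := by
  set Φ := (Fintype.piFinset fun _ : V => E).filter fun φ => Function.Injective φ ∧
    ∀ (u v : V) (h : G.Adj u v), δ (φ u) (φ v) = w ⟨s(u, v), G.mem_edgeSet.mpr h⟩ with hΦ
  let F : (Fin (Fintype.card V) ≃ V) × (V → Plane) → Fin (Fintype.card V) → Plane :=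
    fun z => z.2 ∘ z.1
  have hsub : {x : Fin (Fintype.card V) → Plane | (∀ i, x i ∈ E) ∧ IsConfiguration δ G w x} ⊆
      (((Finset.univ ×ˢ Φ).image F : Finset _) : Set (Fin (Fintype.card V) → Plane)) := by
    rintro x ⟨hxE, φ, hφ, hw⟩
    have hinj : Function.Injective φ := Set.injOn_univ.1 hφ.injOn
    have hrange : Set.range φ = Set.range x := by rw [← Set.image_univ]; exact hφ.image_eq
    have hex : ∀ i, ∃ v, φ v = x i := fun i => by
      have : x i ∈ Set.range φ := hrange ▸ Set.mem_range_self i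
      exact this
    -- `σ` records the order in which the tuple lists the vertices, so a tuple is a labelled
    -- configuration together with an ordering of `V`.
    choose σ hσ using hex
    have hsurj : Function.Surjective σ := by
      intro v
      have : φ v ∈ Set.range x := hrange ▸ Set.mem_range_self v
      obtain ⟨i, hi⟩ := this
      exact ⟨i, hinj ((hσ i).trans hi)⟩
    have hbij : Function.Bijective σ :=
      (Fintype.bijective_iff_surjective_and_card σ).2 ⟨hsurj, by simp⟩
    refine Finset.mem_coe.2 (Finset.mem_image.2 ⟨(Equiv.ofBijective σ hbij, φ), ?_, ?_⟩)
    · simp only [hΦ, Finset.mem_product, Finset.mem_univ, true_and, Finset.mem_filter,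
        Fintype.mem_piFinset]
      refine ⟨fun v => ?_, hinj, hw⟩
      obtain ⟨i, rfl⟩ := hsurj v
      rw [hσ]
      exact hxE i
    · funext i
      exact hσ i
  have h1 := Set.ncard_le_ncard hsub (Finset.finite_toSet _)
  rw [Set.ncard_coe_finset] at h1
  refine h1.trans (Finset.card_image_le.trans ?_)
  rw [Finset.card_product, Finset.card_univ]

open Classical in
/-- The number of labelled configurations is at most the product of the numbers of placements of
the pieces of a cover, times the number of placements of the remaining vertices. -/
theorem card_labelled_configurations_le {V : Type*} [Fintype V] (δ : Plane → Plane → ℝ)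
    (G : SimpleGraph V) (H : G.Subgraph) {s t : ℕ} (hH : CanBeCovered H.coe s t)
    (w : G.edgeSet → ℝ) (E : Finset Plane) {A B : ℝ}
    (hA : ∀ e, (((E ×ˢ E).filter fun z => z.1 ≠ z.2 ∧ δ z.1 z.2 = w e).card : ℝ) ≤ A)
    (hB : ∀ e e', (((E ×ˢ E ×ˢ E).filter fun z => z.1 ≠ z.2.2 ∧ δ z.1 z.2.1 = w e ∧
      δ z.2.1 z.2.2 = w e').card : ℝ) ≤ B) :
    (((Fintype.piFinset fun _ : V => E).filter fun φ => Function.Injective φ ∧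
      ∀ (u v : V) (h : G.Adj u v),
        δ (φ u) (φ v) = w ⟨s(u, v), G.mem_edgeSet.mpr h⟩).card : ℝ) ≤
      A ^ s * B ^ t * (E.card : ℝ) ^ H.vertsᶜ.ncard := by
  obtain ⟨p, q, hbij⟩ := hH
  have hp : ∀ a, G.Adj (p a 0) (p a 1) := fun a => H.adj_sub
    ((p a).toHom.map_adj (by simp [SimpleGraph.pathGraph_adj]))
  have hq1 : ∀ b, G.Adj (q b 0) (q b 1) := fun b => H.adj_sub
    ((q b).toHom.map_adj (by simp [SimpleGraph.pathGraph_adj]))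
  have hq2 : ∀ b, G.Adj (q b 1) (q b 2) := fun b => H.adj_sub
    ((q b).toHom.map_adj (by simp [SimpleGraph.pathGraph_adj]))
  -- The ends of a three-vertex path need not be adjacent, so their distinctness comes from
  -- injectivity of the copy.
  have hq3 : ∀ b, (q b 0 : V) ≠ q b 2 := fun b h => by
    have := (q b).injective (Subtype.ext h)
    exact absurd this (by decide)
  let PA : Fin s → Finset (Plane × Plane) := fun a => (E ×ˢ E).filter fun z =>
    z.1 ≠ z.2 ∧ δ z.1 z.2 = w ⟨_, G.mem_edgeSet.mpr (hp a)⟩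
  let PB : Fin t → Finset (Plane × Plane × Plane) := fun b => (E ×ˢ E ×ˢ E).filter fun z =>
    z.1 ≠ z.2.2 ∧ δ z.1 z.2.1 = w ⟨_, G.mem_edgeSet.mpr (hq1 b)⟩ ∧
      δ z.2.1 z.2.2 = w ⟨_, G.mem_edgeSet.mpr (hq2 b)⟩
  have hcard : ((Fintype.piFinset fun _ : V => E).filter fun φ => Function.Injective φ ∧
      ∀ (u v : V) (h : G.Adj u v), δ (φ u) (φ v) = w ⟨s(u, v), G.mem_edgeSet.mpr h⟩).card ≤
      (Fintype.piFinset PA ×ˢ Fintype.piFinset PB ×ˢ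
        Fintype.piFinset fun _ : (H.vertsᶜ : Set V) => E).card := by
    refine Finset.card_le_card_of_injOn (fun φ => (fun a => (φ (p a 0), φ (p a 1)),
      fun b => (φ (q b 0), φ (q b 1), φ (q b 2)), fun v => φ v)) (fun φ hφ => ?_) ?_
    · simp only [Finset.coe_filter, Set.mem_ofPred_eq, Fintype.mem_piFinset] at hφ
      obtain ⟨hE, hinj, hw⟩ := hφ
      simp only [Finset.mem_coe, Finset.mem_product, Fintype.mem_piFinset, PA, PB,
        Finset.mem_filter]
      exact ⟨fun a => ⟨⟨hE _, hE _⟩, hinj.ne (hp a).ne, hw _ _ (hp a)⟩,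
        fun b => ⟨⟨hE _, hE _, hE _⟩, hinj.ne (hq3 b), hw _ _ (hq1 b), hw _ _ (hq2 b)⟩,
        fun v => hE _⟩
    · intro φ _ ψ _ h
      simp only [Prod.mk.injEq] at h
      obtain ⟨h1, h2, h3⟩ := h
      funext v
      -- The pieces cover `H`, so `φ` can be recovered from its restrictions.
      by_cases hv : v ∈ H.verts
      · obtain ⟨i, hi⟩ := hbij.2 ⟨v, hv⟩
        have hi' := congrArg Subtype.val hi
        simp only at hi'
        rw [← hi']
        rcases i with ⟨a, j⟩ | ⟨b, j⟩
        · have := congrFun h1 a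
          simp only [Prod.mk.injEq] at this
          fin_cases j
          · exact this.1
          · exact this.2
        · have := congrFun h2 b
          simp only [Prod.mk.injEq] at this
          fin_cases j
          · exact this.1
          · exact this.2.1
          · exact this.2.2
      · exact congrFun h3 ⟨v, hv⟩
  have hcard' := (Nat.cast_le (α := ℝ)).2 hcard
  refine hcard'.trans ?_
  rw [Finset.card_product, Finset.card_product, Fintype.card_piFinset, Fintype.card_piFinset,
    Fintype.card_piFinset, Finset.prod_const, Finset.card_univ, ← Nat.card_eq_fintype_card,
    Nat.card_coe_set_eq]
  push_cast
  rw [← mul_assoc]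
  have e1 : ∏ a, ((PA a).card : ℝ) ≤ A ^ s := by
    simpa using Finset.prod_le_prod (s := Finset.univ) (f := fun a => ((PA a).card : ℝ))
      (g := fun _ => A) (fun _ _ => by positivity) (fun a _ => hA _)
  have e2 : ∏ b, ((PB b).card : ℝ) ≤ B ^ t := by
    simpa using Finset.prod_le_prod (s := Finset.univ) (f := fun b => ((PB b).card : ℝ))
      (g := fun _ => B) (fun _ _ => by positivity) (fun b _ => hB _ _)
  have e1' : (0 : ℝ) ≤ ∏ a, ((PA a).card : ℝ) := by positivity
  have e3 : (0 : ℝ) ≤ A ^ s := e1'.trans e1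
  gcongr

-- The pair and path estimates are hypotheses so that distances and dot products share one
-- computation; the resulting constant does not involve the weights.
open Classical in
theorem maxTupleCount_isConfiguration_le {V : Type*} [Fintype V] (δ : Plane → Plane → ℝ)
    (G : SimpleGraph V) (H : G.Subgraph) {s t : ℕ} (hH : CanBeCovered H.coe s t)
    (w : G.edgeSet → ℝ) {n : ℕ} (hn : 0 < n)
    (hA : ∀ (E : Finset Plane) e, (((E ×ˢ E).filter fun z => z.1 ≠ z.2 ∧
      δ z.1 z.2 = w e).card : ℝ) ≤ 16 * (E.card : ℝ) ^ (4 / 3 : ℝ))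
    (hB : ∀ (E : Finset Plane) e e', ((E ×ˢ E ×ˢ E).filter fun z => z.1 ≠ z.2.2 ∧
      δ z.1 z.2.1 = w e ∧ δ z.2.1 z.2.2 = w e').card ≤ 2 * E.card ^ 2) :
    (maxTupleCount (IsConfiguration δ G w) n : ℝ) ≤
      (Fintype.card (Fin (Fintype.card V) ≃ V) * (16 ^ s * 2 ^ t) : ℝ) *
        (n : ℝ) ^ ((4 / 3 : ℝ) * s + 2 * t + (H.vertsᶜ.ncard : ℝ)) := by
  obtain ⟨E, hE, hcount⟩ := (maxTupleCount_isGreatest (IsConfiguration δ G w) n).1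
  have hn0 : (0 : ℝ) < n := by exact_mod_cast hn
  have h1 := (Nat.cast_le (α := ℝ)).2 (tupleCount_isConfiguration_le δ G w E)
  push_cast at h1
  have h2 := card_labelled_configurations_le δ G H hH w E (hA E)
    (B := 2 * (E.card : ℝ) ^ 2) (fun e e' => by exact_mod_cast hB E e e')
  rw [← hcount]
  refine h1.trans ?_
  rw [mul_assoc]
  refine mul_le_mul_of_nonneg_left (h2.trans_eq ?_) (by positivity)
  rw [hE, Real.rpow_add hn0, Real.rpow_add hn0, Real.rpow_mul hn0.le, Real.rpow_mul hn0.le,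
    Real.rpow_natCast, Real.rpow_natCast, Real.rpow_natCast, Real.rpow_ofNat, mul_pow, mul_pow]
  ring

theorem mainTheorem12 {V : Type*} [Fintype V] (G : SimpleGraph V) (H : G.Subgraph) (s t : ℕ)
    (hH : CanBeCovered H.coe s t) :
    ∃ (C : ℝ) (N : ℕ), ∀ n : ℕ, N < n →
      (∀ w : G.edgeSet → ℝ,
        (maxDistanceConfigurations G w n : ℝ) ≤
          C * (n : ℝ) ^ ((4 / 3 : ℝ) * s + 2 * t + (H.vertsᶜ.ncard : ℝ))) ∧
      (∀ w : G.edgeSet → ℝ, (∀ e, w e ≠ 0) →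
        (maxDotProductConfigurations G w n : ℝ) ≤
          C * (n : ℝ) ^ ((4 / 3 : ℝ) * s + 2 * t + (H.vertsᶜ.ncard : ℝ))) := by
  classical
  -- The constant is |V|! · 16^s · 2^t. The threshold 0 suffices, since only positivity of `n` is
  -- needed to split the real power.
  refine ⟨Fintype.card (Fin (Fintype.card V) ≃ V) * (16 ^ s * 2 ^ t), 0, fun n hn =>
    ⟨fun w => ?_, fun w hw => ?_⟩⟩
  · refine maxTupleCount_isConfiguration_le (fun p q => dist p q) G H hH w hn (fun E e => ?_)
      (fun E e e' => ?_)
    · convert card_pairs_dist_le E (w e)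
    · convert card_triples_dist_le E (w e) (w e')
  · refine maxTupleCount_isConfiguration_le (fun p q => inner ℝ p q) G H hH w hn (fun E e => ?_)
      (fun E e e' => ?_)
    · convert card_pairs_inner_le E (hw e)
    · convert card_triples_inner_le E (hw e)
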